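/- **Setting.** Graphs are finite undirected multigraphs. An $r$-way cut of a graph is a partition of its vertex set into $r$ nonempty clusters, and a cut is an $r$-way cut with $r\ge 2$; its size is the number of crossing edges (edges joining different clusters), and it is compact if every cluster induces a connected subgraph. A *distance-cumulative* property $\Phi$ assigns to each connected graph $G$ with edge weights $w\ge 0$ a real number $\Phi(G)\ge 0$ (and $\Phi(G)=\infty$ if $G$ is disconnected) such that for every connected $G$: - multiplying all weights by $r\ge 0$ multiplies $\Phi(G)$ by $r$; - increasing the weight of one edge by $r\ge0$ does not decrease $\Phi(G)$ and increases it by at most $r$; - $\Phi(G/e)=\Phi(G)$ if $w(e)=0$; - $\Phi(G-e)=\Phi(G)$ if $e\neq e'$ are parallel and $w(e)\ge w(e')$; - if $\Phi(G)>0$, then $\Phi(G)\ge\min_e w(e)$; - $\Phi(G)=0$ if and only if $G$ stays connected after all edges of positive weight are removed. Let $G$ be a connected graph with $n\ge 2$ vertices in which each edge $e$, independently of the others, takes on its heavy phase $W_e^H$ (its weight is then $W_e^H$) with probability $p_e\in(0,1)$ and its light phase $W_e^L$ with probability $1-p_e$, where $W_e^H\ge W_e^L\ge 0$ and $W_e^H>0$.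 Let $X=\Phi(G)$, let $E^0=\{e : W_e^L=0\}$, let $G^0$ be the graph on the vertices of $G$ with edge set $E^0$, and suppose that $p_e=p$ for all $e\in E^0$. Let $\chi$ be the minimum size of a cut of $G^0$. Put $c=(5+\sqrt{17})/2$ and assume that $\Pr[X>0]<n^{-c}$ (in particular, $G^0$ is connected). **Statement.** There is a universal constant $\varepsilon_0>0$ such that, for every $G$, $\Phi$, $p$ as above and every $0<\varepsilon\le\varepsilon_0$, the following holds. Let $$\alpha=\frac{c-1+\ln(1/\varepsilon)/\ln n}{2}$$ and let $\mathcal C$ be the collection of all compact cuts of $G^0$ of size at most $\alpha\chi$. Then the probability that there exists a compact cut $C\notin\mathcal C$ of $G^0$ all of whose crossing edges (in $E^0$) take on their heavy phases is at most $$\frac{\varepsilon\,p^{\chi}}{4}\;\le\;\frac{\varepsilon\cdot\Pr[X>0]}{4}.$$ -/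

import Mathlib

open scoped NNReal ENNReal

universe u v

noncomputable section

/-- An undirected multigraph (parallel edges and loops allowed) with vertex set `V` and edge
set `E`, given by the unordered pair of endpoints of each edge. -/
structure Multigraph (V : Type u) (E : Type v) where
  ends : E → Sym2 V

namespace Multigraph

variable {V : Type u} {E : Type v}

/-- The simple graph of all pairs of distinct vertices that are joined by at least one edge. -/
def toSimple (G : Multigraph V E) : SimpleGraph V :=
  SimpleGraph.fromEdgeSet (Set.range G.ends)

/-- Connectivity (with at least one vertex). Loops and multiplicities are irrelevant. -/
def Connected (G : Multigraph V E) : Prop :=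
  G.toSimple.Connected

/-- The subgraph induced on the vertex set `U` is connected. -/
def ConnectedOn (G : Multigraph V E) (U : Set V) : Prop :=
  (G.toSimple.induce U).Connected

/-- The graph with the same vertices whose edges are the edges of `G` that lie in `S`. -/
def restrict (G : Multigraph V E) (S : Set E) : Multigraph V S where
  ends e := G.ends e

/-- The equivalence relation on vertices that identifies the endpoints of the edge `e`. -/
def contractSetoid (G : Multigraph V E) (e : E) : Setoid V where
  r x y := x = y ∨ (x ∈ G.ends e ∧ y ∈ G.ends e)
  iseqv :=
    { refl := fun _ => Or.inl rfl
      symm := by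
        rintro x y (h | ⟨hx, hy⟩)
        · exact Or.inl h.symm
        · exact Or.inr ⟨hy, hx⟩
      trans := by
        rintro x y z (rfl | ⟨hx, hy⟩) (rfl | ⟨hy', hz⟩)
        · exact Or.inl rfl
        · exact Or.inr ⟨hy', hz⟩
        · exact Or.inr ⟨hx, hy⟩
        · exact Or.inr ⟨hx, hz⟩ }

/-- The contraction `G / e`: the endpoints of `e` are identified and `e` is removed; all other
edges are kept, edges parallel to `e` becoming loops. -/
def contract (G : Multigraph V E) (e : E) :
    Multigraph (Quotient (G.contractSetoid e)) {f : E // f ≠ e} where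
  ends f := Sym2.map (Quotient.mk (G.contractSetoid e)) (G.ends f)

/-! Cuts. A partition of the vertex set is represented by the equivalence relation whose
classes are its clusters. -/

/-- A cut is a partition of the vertex set into at least two (nonempty) clusters. -/
def IsCut (C : Setoid V) : Prop :=
  2 ≤ C.classes.ncard

/-- The set of edges whose endpoints lie in different clusters of `C`. -/
def crossing (G : Multigraph V E) (C : Setoid V) : Set E :=
  {e | ∃ x y, G.ends e = s(x, y) ∧ ¬ C x y}

/-- The size of a cut is the number of its crossing edges. -/
def cutSize (G : Multigraph V E) (C : Setoid V) : ℕ :=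
  (G.crossing C).ncard

/-- A compact cut: every cluster induces a connected subgraph. -/
def IsCompactCut (G : Multigraph V E) (C : Setoid V) : Prop :=
  IsCut C ∧ ∀ U ∈ C.classes, G.ConnectedOn U

/-- The size of a min cut (a cut exists as soon as there are two vertices). -/
def minCutSize (G : Multigraph V E) : ℕ :=
  sInf {k | ∃ C : Setoid V, IsCut C ∧ G.cutSize C = k}

/-- The compact cuts of size at most `b`. -/
def compactCutsUpTo (G : Multigraph V E) (b : ℝ) : Set (Setoid V) :=
  {C | G.IsCompactCut C ∧ (G.cutSize C : ℝ) ≤ b}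

end Multigraph

/-- A finite multigraph with nonnegative real edge weights. -/
structure WeightedGraph where
  V : Type u
  E : Type v
  finV : Finite V
  finE : Finite E
  graph : Multigraph V E
  weight : E → ℝ≥0

namespace WeightedGraph

/-- All weights are multiplied by `r`. -/
def scale (G : WeightedGraph.{u, v}) (r : ℝ≥0) : WeightedGraph.{u, v} :=
  { G with weight := fun e => r * G.weight e }

open Classical in
/-- The weight of the edge `e` is increased by `r`. -/
def increase (G : WeightedGraph.{u, v}) (e : G.E) (r : ℝ≥0) : WeightedGraph.{u, v} :=
  { G with weight := fun f => if f = e then G.weight f + r else G.weight f }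

/-- Contraction of the edge `e`. -/
def contract (G : WeightedGraph.{u, v}) (e : G.E) : WeightedGraph.{u, v} where
  V := Quotient (G.graph.contractSetoid e)
  E := {f : G.E // f ≠ e}
  finV := by
    have := G.finV
    infer_instance
  finE := by
    have := G.finE
    infer_instance
  graph := G.graph.contract e
  weight f := G.weight f

/-- Deletion of the edge `e`. -/
def delete (G : WeightedGraph.{u, v}) (e : G.E) : WeightedGraph.{u, v} where
  V := G.V
  E := ({e}ᶜ : Set G.E)
  finV := G.finV
  finE := by
    have := G.finE
    infer_instance
  graph := G.graph.restrict {e}ᶜ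
  weight f := G.weight f

end WeightedGraph

/-- Distance-cumulative weighted graph properties: a nonnegative real number is assigned to each
connected weighted graph, subject to the requirements below, and `∞` to each disconnected one. -/
structure IsDistanceCumulative (Φ : WeightedGraph.{u, v} → ℝ≥0∞) : Prop where
  ne_top : ∀ G, G.graph.Connected → Φ G ≠ ∞
  eq_top : ∀ G, ¬ G.graph.Connected → Φ G = ∞
  scale : ∀ G, G.graph.Connected → ∀ r : ℝ≥0, Φ (G.scale r) = r * Φ G
  additive : ∀ G, G.graph.Connected → ∀ (e : G.E) (r : ℝ≥0),
    Φ G ≤ Φ (G.increase e r) ∧ Φ (G.increase e r) ≤ Φ G + r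
  contract : ∀ G, G.graph.Connected → ∀ e : G.E, G.weight e = 0 → Φ (G.contract e) = Φ G
  parallel : ∀ G, G.graph.Connected → ∀ e e' : G.E, e ≠ e' → G.graph.ends e = G.graph.ends e' →
    G.weight e' ≤ G.weight e → Φ (G.delete e) = Φ G
  /-- If positive, the value is at least the minimum edge weight. -/
  bounds : ∀ G, G.graph.Connected → 0 < Φ G → ∃ e : G.E, (G.weight e : ℝ≥0∞) ≤ Φ G
  positive : ∀ G, G.graph.Connected →
    (Φ G = 0 ↔ (G.graph.restrict {e | G.weight e = 0}).Connected)

/-- A biased coin weighted graph: independently of the other edges, the edge `e` takes on its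
heavy phase with probability `prob e` and its light phase with probability `1 - prob e`. -/
structure BCWGraph (V : Type u) (E : Type v) where
  graph : Multigraph V E
  heavy : E → ℝ≥0
  light : E → ℝ≥0
  light_le_heavy : ∀ e, light e ≤ heavy e
  prob : E → ℝ
  prob_pos : ∀ e, 0 < prob e
  prob_lt_one : ∀ e, prob e < 1

namespace BCWGraph

variable {V : Type u} {E : Type v}

/-- The weighted graph of an instance `I`, where `I e = true` means that the edge `e` takes on
its heavy phase and `I e = false` that it takes on its light phase. -/
def realize [Finite V] [Finite E] (G : BCWGraph V E) (I : E → Bool) : WeightedGraph.{u, v} where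
  V := V
  E := E
  finV := inferInstance
  finE := inferInstance
  graph := G.graph
  weight e := if I e then G.heavy e else G.light e

open Classical in
/-- The probability of a set `A` of instances: the phases of the edges are independent. -/
def Pr [Fintype E] (G : BCWGraph V E) (A : Set (E → Bool)) : ℝ :=
  ∑ I : E → Bool, if I ∈ A then ∏ e, (if I e then G.prob e else 1 - G.prob e) else 0

/-- The edges whose light phase is zero. -/
def zeroEdges (G : BCWGraph V E) : Set E :=
  {e | G.light e = 0}

/-- The restriction of the graph to the edges whose light phase is zero. -/
def zeroGraph (G : BCWGraph V E) : Multigraph V G.zeroEdges :=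
  G.graph.restrict G.zeroEdges

/-- The event that all edges of the zero graph that cross `C` take on their heavy phases. -/
def AllHeavy (G : BCWGraph V E) (C : Setoid V) : Set (E → Bool) :=
  {I | ∀ e ∈ G.zeroGraph.crossing C, I e = true}

/-- The event that the random value `X = Φ(G)` is strictly positive. -/
def positiveEvent [Finite V] [Finite E] (G : BCWGraph V E) (Φ : WeightedGraph.{u, v} → ℝ≥0∞) :
    Set (E → Bool) :=
  {I | 0 < Φ (G.realize I)}

end BCWGraph

/-- The constant `c = (5 + √17) / 2`. -/
def cutConst : ℝ := (5 + Real.sqrt 17) / 2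

/-- The threshold `α = (c - 1 + ln (1 / ε) / ln n) / 2`. -/
def cutAlpha (n : ℕ) (ε : ℝ) : ℝ := (cutConst - 1 + Real.log (1 / ε) / Real.log n) / 2

end

/-!
For an edge taken uniformly at random among the `M ≥ nχ/2` edges that are not loops, a partition
`C` with `|C| ≤ aχ/2` avoids it with probability at least `1 - a/n`. If it does, `C` is a partition
of the contracted graph, which has no smaller cuts. Hence the number of such partitions is, by
induction on `n`, at most `n! / Γ(n + 1 - a)`, and log-convexity of the Gamma function bounds this
by `n ^ a`: at most `n ^ (2b)` partitions have size at most `bχ` (Karger's bound).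

All crossing edges of `C` are heavy with probability `p ^ |C|`, and this event forces `Φ > 0`; for a
minimum cut this gives `p ^ χ ≤ Pr[X > 0] < n ^ (-c)`. By the union bound, the event in question has
probability at most the sum of `p ^ |C| = (p ^ χ) ^ (|C| / χ)` over all partitions with
`|C| > αχ`. Since `n² p ^ χ` is much smaller than `1`, a dyadic decomposition bounds this sum by
`4 (n² p ^ χ) ^ α`, a constant times the bound on the terms with `|C| / χ` close to `α`. As `c`
solves `(c - 1)(c - 2) / 2 = c`, the definition of `α` turns this into a multiple of
`ε ^ ((c - 2) / 2) p ^ χ`, and `(c - 2) / 2 > 1`.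
-/

section PartitionCount

/-- The least element of the class of `x`, a canonical choice of representatives which encodes an
equivalence relation as a function `f` with `f x ≤ x`. -/
noncomputable def leastRep {α : Type*} [LinearOrder α] [WellFoundedLT α] (C : Setoid α) (x : α) :
    α :=
  wellFounded_lt.min {y | C y x} ⟨x, C.refl x⟩

variable {α : Type*} [LinearOrder α] [WellFoundedLT α]

theorem leastRep_rel (C : Setoid α) (x : α) : C (leastRep C x) x :=
  wellFounded_lt.min_mem {y | C y x} ⟨x, C.refl x⟩

theorem leastRep_le (C : Setoid α) (x : α) : leastRep C x ≤ x :=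
  wellFounded_lt.min_le (s := {y | C y x}) (C.refl x)

theorem leastRep_eq_leastRep_iff {C : Setoid α} {x y : α} :
    leastRep C x = leastRep C y ↔ C x y := by
  refine ⟨fun h => C.trans (C.symm (leastRep_rel C x)) (h ▸ leastRep_rel C y), fun h => ?_⟩
  have hclass : {z | C z x} = {z | C z y} :=
    Set.ext fun z => ⟨fun hz => C.trans hz h, fun hz => C.trans hz (C.symm h)⟩
  simp only [leastRep, hclass]

theorem leastRep_injective : Function.Injective (leastRep : Setoid α → α → α) := by
  intro C D h
  ext x y
  rw [← leastRep_eq_leastRep_iff, h, leastRep_eq_leastRep_iff]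

end PartitionCount

instance instFiniteSetoid (V : Type*) [Finite V] : Finite (Setoid V) :=
  Finite.of_injective (fun C : Setoid V => (C : V → V → Prop)) fun _ _ h =>
    Setoid.ext fun x y => iff_of_eq (congrFun₂ h x y)

theorem natCard_setoid_fin_le (n : ℕ) : Nat.card (Setoid (Fin n)) ≤ n.factorial := by
  let rep (C : Setoid (Fin n)) (i : Fin n) : Set.Iic i := ⟨leastRep C i, leastRep_le C i⟩
  have hrep : Function.Injective rep := fun C D h =>
    leastRep_injective <| funext fun i => congrArg Subtype.val (congrFun h i)
  calc Nat.card (Setoid (Fin n)) ≤ Nat.card (∀ i : Fin n, Set.Iic i) :=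
        Nat.card_le_card_of_injective rep hrep
    _ = ∏ i : Fin n, ((i : ℕ) + 1) := by simp
    _ = n.factorial := by
        rw [Fin.prod_univ_eq_prod_range (· + 1), Finset.prod_range_add_one_eq_factorial]

theorem natCard_setoid_le_factorial (V : Type*) [Finite V] :
    Nat.card (Setoid V) ≤ (Nat.card V).factorial := by
  let e := Finite.equivFin V
  have hcomap : Function.Injective (Setoid.comap e.symm) := fun C D h => by
    ext x y
    simpa only [Setoid.comap_rel, Equiv.symm_apply_apply] using Setoid.ext_iff.1 h (e x) (e y)
  exact (Nat.card_le_card_of_injective _ hcomap).trans (natCard_setoid_fin_le _)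

theorem Gamma_le_one_of_mem_Icc {x : ℝ} (hx : x ∈ Set.Icc 1 2) : Real.Gamma x ≤ 1 := by
  simpa only [Real.Gamma_one, Real.Gamma_two, max_self] using
    Real.convexOn_Gamma.le_max_of_mem_Icc (Set.mem_Ioi.2 one_pos) (Set.mem_Ioi.2 two_pos) hx

theorem Gamma_add_one_le_rpow_mul_Gamma {x a : ℝ} (ha : 1 ≤ a) (hax : a < x + 1) :
    Real.Gamma (x + 1) ≤ x ^ a * Real.Gamma (x + 1 - a) := by
  have hx : 0 < x := by linarith
  have hΓ : 0 < Real.Gamma (x + 1 - a) := Real.Gamma_pos_of_pos (by linarith)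
  have hslope := Real.convexOn_log_Gamma.secant_mono (a := x + 1) (x := x + 1 - a) (y := x)
    (by simp; linarith) (by simp; linarith) hx (by linarith) (by linarith) (by linarith)
  have hrec : Real.log (Real.Gamma (x + 1)) = Real.log x + Real.log (Real.Gamma x) := by
    rw [Real.Gamma_add_one hx.ne', Real.log_mul hx.ne' (Real.Gamma_pos_of_pos hx).ne']
  have hlog : Real.log (Real.Gamma (x + 1)) ≤
      a * Real.log x + Real.log (Real.Gamma (x + 1 - a)) := by
    simp only [Function.comp_apply, hrec, sub_add_cancel_left, sub_sub_cancel_left] at hslope ⊢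
    rw [div_neg, div_neg, neg_le_neg_iff, div_one, le_div_iff₀ (by linarith)] at hslope
    linarith
  rw [← Real.log_le_log_iff (Real.Gamma_pos_of_pos (by linarith)) (by positivity),
    Real.log_mul (by positivity) hΓ.ne', Real.log_rpow hx]
  exact hlog

/-- Dyadic decomposition: at most `2 ^ (k + 1) * K` of the `u i` lie in `[2 ^ k, 2 ^ (k + 1))`. -/
theorem sum_inv_sq_le_of_card_filter_le {ι : Type*} {F : Finset ι} {u : ι → ℝ} {K : ℝ}
    (hu : ∀ i ∈ F, 1 ≤ u i)
    (hcard : ∀ t, 1 ≤ t → (({i ∈ F | u i ≤ t} : Finset ι).card : ℝ) ≤ K * t) :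
    ∑ i ∈ F, (u i ^ 2)⁻¹ ≤ 4 * K := by
  classical
  have hK : 0 ≤ K := by simpa using (Nat.cast_nonneg _).trans (hcard 1 le_rfl)
  choose! k hk hk' using fun i (hi : i ∈ F) => exists_nat_pow_near (hu i hi) one_lt_two
  have hdyadic (j : ℕ) : ∑ i ∈ F with k i = j, (u i ^ 2)⁻¹ ≤ 2 * K * (1 / 2) ^ j := by
    have hsubset : ({i ∈ F | k i = j} : Finset ι) ⊆ {i ∈ F | u i ≤ 2 ^ (j + 1)} := by
      intro i hi
      obtain ⟨hiF, rfl⟩ := Finset.mem_filter.1 hi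
      exact Finset.mem_filter.2 ⟨hiF, (hk' i hiF).le⟩
    calc ∑ i ∈ F with k i = j, (u i ^ 2)⁻¹
        ≤ ({i ∈ F | k i = j} : Finset ι).card • (((2 : ℝ) ^ j) ^ 2)⁻¹ := by
          refine Finset.sum_le_card_nsmul _ _ _ fun i hi => ?_
          obtain ⟨hiF, rfl⟩ := Finset.mem_filter.1 hi
          gcongr
          exact hk i hiF
      _ ≤ K * 2 ^ (j + 1) * (((2 : ℝ) ^ j) ^ 2)⁻¹ := by
          rw [nsmul_eq_mul]
          gcongr
          exact (Nat.cast_le.2 (Finset.card_le_card hsubset)).trans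
            (hcard _ (one_le_pow₀ one_le_two))
      _ = 2 * K * (1 / 2) ^ j := by
          rw [one_div, inv_pow]
          field_simp
          ring
  calc ∑ i ∈ F, (u i ^ 2)⁻¹
      = ∑ j ∈ F.image k, ∑ i ∈ F with k i = j, (u i ^ 2)⁻¹ :=
        (Finset.sum_fiberwise_of_maps_to (fun i hi => Finset.mem_image_of_mem k hi) _).symm
    _ ≤ ∑ j ∈ F.image k, 2 * K * (1 / 2) ^ j := Finset.sum_le_sum fun j _ => hdyadic j
    _ ≤ ∑' j : ℕ, 2 * K * (1 / 2) ^ j :=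
        (summable_geometric_two.mul_left _).sum_le_tsum _ fun j _ => by positivity
    _ = 4 * K := by rw [tsum_mul_left, tsum_geometric_two]; ring

theorem sum_rpow_le_of_card_filter_le {ι : Type*} {F : Finset ι} {s : ι → ℝ} {B x α : ℝ}
    (hB : 1 < B) (hx₀ : 0 < x) (hx : x ≤ B ^ (-2 : ℝ)) (hs : ∀ i ∈ F, α ≤ s i)
    (hcard : ∀ b, α ≤ b → (({i ∈ F | s i ≤ b} : Finset ι).card : ℝ) ≤ B ^ b) :
    ∑ i ∈ F, x ^ s i ≤ 4 * (B * x) ^ α := by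
  have hB₀ : 0 < B := by linarith
  have hterm : ∀ i ∈ F, x ^ s i ≤ x ^ α * ((B ^ (s i - α)) ^ 2)⁻¹ := fun i hi =>
    calc x ^ s i = x ^ α * x ^ (s i - α) := by rw [← Real.rpow_add hx₀, add_sub_cancel]
      _ ≤ x ^ α * (B ^ (-2 : ℝ)) ^ (s i - α) := by
          gcongr
          exact sub_nonneg.2 (hs i hi)
      _ = x ^ α * ((B ^ (s i - α)) ^ 2)⁻¹ := by
          rw [← Real.rpow_natCast, ← Real.rpow_mul hB₀.le, ← Real.rpow_mul hB₀.le,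
            ← Real.rpow_neg hB₀.le]
          push_cast
          ring_nf
  have hsum : ∑ i ∈ F, ((B ^ (s i - α)) ^ 2)⁻¹ ≤ 4 * B ^ α := by
    refine sum_inv_sq_le_of_card_filter_le
      (fun i hi => Real.one_le_rpow hB.le (sub_nonneg.2 (hs i hi))) fun t ht => ?_
    have ht₀ : 0 < t := by linarith
    calc (({i ∈ F | B ^ (s i - α) ≤ t} : Finset ι).card : ℝ)
        = ({i ∈ F | s i ≤ α + Real.logb B t} : Finset ι).card := by
          simp only [← Real.le_logb_iff_rpow_le hB ht₀, sub_le_iff_le_add']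
      _ ≤ B ^ (α + Real.logb B t) := hcard _ (le_add_of_nonneg_right (Real.logb_nonneg hB ht))
      _ = B ^ α * t := by rw [Real.rpow_add hB₀, Real.rpow_logb hB₀ hB.ne' ht₀]
  calc ∑ i ∈ F, x ^ s i ≤ ∑ i ∈ F, x ^ α * ((B ^ (s i - α)) ^ 2)⁻¹ := Finset.sum_le_sum hterm
    _ = x ^ α * ∑ i ∈ F, ((B ^ (s i - α)) ^ 2)⁻¹ := (Finset.mul_sum ..).symm
    _ ≤ x ^ α * (4 * B ^ α) := by gcongr
    _ = 4 * (B * x) ^ α := by rw [Real.mul_rpow hB₀.le hx₀.le]; ring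

namespace Multigraph

variable {V : Type u} {E : Type v} {G : Multigraph V E} {e : E}

theorem mem_crossing_iff_of_ends_eq {x y : V} (he : G.ends e = s(x, y)) {C : Setoid V} :
    e ∈ G.crossing C ↔ ¬ C x y := by
  refine ⟨?_, fun hC => ⟨x, y, he, hC⟩⟩
  rintro ⟨x', y', he', hC⟩
  rcases Sym2.eq_iff.1 (he.symm.trans he') with ⟨rfl, rfl⟩ | ⟨rfl, rfl⟩
  exacts [hC, fun h => hC (C.symm h)]

theorem mem_crossing_bot_iff : e ∈ G.crossing ⊥ ↔ ¬ (G.ends e).IsDiag := by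
  induction he : G.ends e with
  | _ x y => simp [mem_crossing_iff_of_ends_eq he]

theorem mem_crossing_ker_eq_iff {v : V} :
    e ∈ G.crossing (Setoid.ker (· = v)) ↔ e ∈ G.crossing ⊥ ∧ v ∈ G.ends e := by
  induction he : G.ends e with
  | _ x y =>
    simp only [mem_crossing_iff_of_ends_eq he, Setoid.ker_def, Sym2.mem_iff,
      eq_iff_iff]
    grind

theorem isCut_iff_exists_not_rel [Finite V] {C : Setoid V} : IsCut C ↔ ∃ x y, ¬ C x y := by
  rw [IsCut, Nat.succ_le_iff, Set.one_lt_ncard]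
  constructor
  · rintro ⟨_, ⟨x, rfl⟩, _, ⟨y, rfl⟩, hne⟩
    refine ⟨x, y, fun hxy => hne (Set.ext fun z => ?_)⟩
    exact ⟨fun hz => C.trans hz hxy, fun hz => C.trans hz (C.symm hxy)⟩
  · rintro ⟨x, y, hxy⟩
    refine ⟨_, C.mem_classes x, _, C.mem_classes y, fun heq => hxy ?_⟩
    exact heq.subset (C.refl x)

theorem isCut_ker_eq [Finite V] [Nontrivial V] (v : V) : IsCut (Setoid.ker (· = v)) := by
  obtain ⟨w, hw⟩ := exists_ne v
  exact isCut_iff_exists_not_rel.2 ⟨w, v, by simpa [Setoid.ker_def] using hw⟩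

theorem isCut_comap_mk [Finite V] {r : Setoid V} {D : Setoid (Quotient r)} (hD : IsCut D) :
    IsCut (D.comap (Quotient.mk r)) := by
  obtain ⟨x, y, hxy⟩ := isCut_iff_exists_not_rel.1 hD
  induction x using Quotient.ind
  induction y using Quotient.ind
  exact isCut_iff_exists_not_rel.2 ⟨_, _, hxy⟩

theorem minCutSize_le_cutSize {C : Setoid V} (hC : IsCut C) : G.minCutSize ≤ G.cutSize C :=
  Nat.sInf_le ⟨C, hC, rfl⟩

theorem exists_cutSize_eq_minCutSize [Finite V] [Nontrivial V] (G : Multigraph V E) :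
    ∃ C : Setoid V, IsCut C ∧ G.cutSize C = G.minCutSize := by
  obtain ⟨v⟩ := (inferInstance : Nonempty V)
  exact Nat.sInf_mem (s := {k | ∃ C, IsCut C ∧ G.cutSize C = k}) ⟨_, _, isCut_ker_eq v, rfl⟩

theorem nonempty_of_minCutSize_pos (h : 0 < G.minCutSize) : Nonempty E := by
  obtain ⟨k, C, hC, rfl⟩ := Nat.nonempty_of_pos_sInf h
  exact (Set.nonempty_of_ncard_ne_zero (h.trans_le (minCutSize_le_cutSize hC)).ne').to_type

theorem Connected.nonempty_crossing [Finite V] (hG : G.Connected) {C : Setoid V} (hC : IsCut C) :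
    (G.crossing C).Nonempty := by
  obtain ⟨x, y, hxy⟩ := isCut_iff_exists_not_rel.1 hC
  by_contra hempty
  obtain ⟨walk⟩ := hG.preconnected x y
  refine hxy ?_
  clear hxy
  induction walk with
  | nil => exact C.refl _
  | cons hadj _ ih =>
    obtain ⟨e, he⟩ := ((SimpleGraph.fromEdgeSet_adj _).1 hadj).1
    exact C.trans (not_not.1 fun hcross => hempty ⟨e, _, _, he, hcross⟩) ih

/-- The non-loop edges at a vertex `v` are those crossing the cut that separates `v` from all other
vertices, so every vertex has at least `χ` of them. -/
theorem card_mul_le_two_mul_cutSize_bot [Finite V] [Nontrivial V] [Finite E] {χ : ℕ}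
    (hχ : ∀ C, IsCut C → χ ≤ G.cutSize C) : Nat.card V * χ ≤ 2 * G.cutSize ⊥ := by
  classical
  have := Fintype.ofFinite V
  have := Fintype.ofFinite E
  rw [Nat.card_eq_fintype_card, mul_comm 2, cutSize, Set.ncard_eq_toFinset_card']
  refine Finset.card_mul_le_card_mul (s := Finset.univ) (fun v e => v ∈ G.ends e) (fun v _ => ?_)
    fun e he => ?_
  · refine (hχ _ (isCut_ker_eq v)).trans_eq ?_
    rw [cutSize, Set.ncard_eq_toFinset_card']
    congr 1
    ext e
    simp [mem_crossing_ker_eq_iff, Finset.mem_bipartiteAbove]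
  · rw [Set.mem_toFinset, mem_crossing_bot_iff] at he
    rw [← Sym2.card_toFinset_of_not_isDiag _ he]
    refine Finset.card_le_card fun v hv => ?_
    simpa [Finset.mem_bipartiteBelow] using hv

theorem cutSize_contract (D : Setoid (Quotient (G.contractSetoid e))) :
    (G.contract e).cutSize D = G.cutSize (D.comap (Quotient.mk _)) := by
  rw [cutSize, cutSize, ← Set.ncard_image_of_injective _ Subtype.val_injective]
  congr 1
  ext f
  induction hf : G.ends f with
  | _ x y =>
    have hcontract (hfe : f ≠ e) : (G.contract e).ends ⟨f, hfe⟩ =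
        s(Quotient.mk (G.contractSetoid e) x, Quotient.mk (G.contractSetoid e) y) := by
      simp [contract, hf]
    rw [mem_crossing_iff_of_ends_eq hf, Setoid.comap_rel]
    constructor
    · rintro ⟨⟨f, hfe⟩, hcross, rfl⟩
      exact (mem_crossing_iff_of_ends_eq (hcontract hfe)).1 hcross
    · intro hxy
      have hfe : f ≠ e := by
        rintro rfl
        have hmerged : G.contractSetoid f x y := Or.inr (by simp [hf])
        exact hxy (Quotient.sound hmerged ▸ D.refl _)
      exact ⟨⟨f, hfe⟩, (mem_crossing_iff_of_ends_eq (hcontract hfe)).2 hxy, rfl⟩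

theorem natCard_quotient_contractSetoid_add_one [Finite V] (he : e ∈ G.crossing ⊥) :
    Nat.card (Quotient (G.contractSetoid e)) + 1 = Nat.card V := by
  obtain ⟨x, y, hends, hxy⟩ := he
  have hmk (u v : V) : Quotient.mk (G.contractSetoid e) u = Quotient.mk _ v ↔
      u = v ∨ (u = x ∨ u = y) ∧ (v = x ∨ v = y) := by
    rw [← Sym2.mem_iff, ← Sym2.mem_iff, ← hends]
    exact Quotient.eq
  have hbij : Function.Bijective
      fun v : ({y}ᶜ : Set V) => Quotient.mk (G.contractSetoid e) v := by
    refine ⟨fun u v huv => ?_, Quotient.ind fun v => ?_⟩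
    · rw [hmk] at huv
      exact Subtype.ext (by grind)
    · rcases eq_or_ne v y with rfl | hv
      · exact ⟨⟨x, hxy⟩, (hmk _ _).2 (by simp)⟩
      · exact ⟨⟨v, hv⟩, rfl⟩
  rw [← Nat.card_eq_of_bijective _ hbij, Nat.card_coe_set_eq, add_comm, ← Set.ncard_singleton y,
    Set.ncard_add_ncard_compl]

/-- The partitions of the vertices, including the one with a single cluster, that are crossed by
at most `b` edges. -/
def partitionsUpTo (G : Multigraph V E) (b : ℝ) : Set (Setoid V) :=
  {C | (G.cutSize C : ℝ) ≤ b}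

theorem mem_partitionsUpTo {C : Setoid V} {b : ℝ} :
    C ∈ G.partitionsUpTo b ↔ (G.cutSize C : ℝ) ≤ b :=
  Iff.rfl

theorem ncard_partitionsUpTo_le_factorial [Finite V] (G : Multigraph V E) (b : ℝ) :
    (G.partitionsUpTo b).ncard ≤ (Nat.card V).factorial :=
  (Set.ncard_le_card _).trans (natCard_setoid_le_factorial V)

theorem ncard_partitionsUpTo_not_crossing_le [Finite V] (G : Multigraph V E) (e : E) (b : ℝ) :
    {C ∈ G.partitionsUpTo b | e ∉ G.crossing C}.ncard ≤
      ((G.contract e).partitionsUpTo b).ncard := by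
  refine (Set.ncard_le_ncard ?_ (Set.toFinite _)).trans
    (Set.ncard_image_le (f := Setoid.comap (Quotient.mk (G.contractSetoid e))))
  rintro C ⟨hCb, heC⟩
  have hle : G.contractSetoid e ≤ C := by
    rintro x y (rfl | ⟨hx, hy⟩)
    · exact C.refl x
    · rcases eq_or_ne x y with rfl | hne
      · exact C.refl x
      · exact not_not.1 fun hxy => heC ⟨x, y, (Sym2.mem_and_mem_iff hne).1 ⟨hx, hy⟩, hxy⟩
  have hcomap : (Setoid.correspondence _ ⟨C, hle⟩).comap (Quotient.mk _) = C :=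
    congrArg Subtype.val ((Setoid.correspondence _).symm_apply_apply ⟨C, hle⟩)
  refine ⟨_, ?_, hcomap⟩
  rwa [mem_partitionsUpTo, cutSize_contract, hcomap]

theorem ncard_partitionsUpTo_mul_cutSize_bot_sub_le [Finite V] [Finite E] {b N : ℝ}
    (hN : ∀ e ∈ G.crossing ⊥, ({C ∈ G.partitionsUpTo b | e ∉ G.crossing C}.ncard : ℝ) ≤ N) :
    ((G.partitionsUpTo b).ncard : ℝ) * (G.cutSize ⊥ - b) ≤ G.cutSize ⊥ * N := by
  classical
  have := Fintype.ofFinite E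
  have := Fintype.ofFinite (Setoid V)
  suffices h : (G.partitionsUpTo b).toFinset.card • ((G.cutSize ⊥ : ℝ) - b) ≤
      (G.crossing ⊥).toFinset.card • N by
    rwa [nsmul_eq_mul, nsmul_eq_mul, ← Set.ncard_eq_toFinset_card',
      ← Set.ncard_eq_toFinset_card'] at h
  refine Finset.card_nsmul_le_card_nsmul (R := ℝ) (fun C e => e ∉ G.crossing C)
    (fun C hC => ?_) fun e he => ?_
  · rw [Set.mem_toFinset, mem_partitionsUpTo] at hC
    have hsplit : (G.cutSize ⊥ : ℝ) ≤ (G.crossing ⊥ \ G.crossing C).ncard + G.cutSize C := by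
      exact_mod_cast Set.ncard_le_ncard_sdiff_add_ncard _ _
    have habove : (G.crossing ⊥).toFinset.bipartiteAbove (fun C e => e ∉ G.crossing C) C =
        (G.crossing ⊥ \ G.crossing C).toFinset := by
      ext e
      simp [Finset.mem_bipartiteAbove]
    rw [habove, ← Set.ncard_eq_toFinset_card']
    exact sub_le_iff_le_add.2 (hsplit.trans (by gcongr))
  · have hbelow : (G.partitionsUpTo b).toFinset.bipartiteBelow (fun C e => e ∉ G.crossing C) e =
        {C ∈ G.partitionsUpTo b | e ∉ G.crossing C}.toFinset := by
      ext C
      simp [Finset.mem_bipartiteBelow]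
    rw [hbelow, ← Set.ncard_eq_toFinset_card']
    exact hN e (Set.mem_toFinset.1 he)

/-- A uniformly random edge that is not a loop avoids a given small partition with probability at
least `1 - a / n`. -/
theorem ncard_partitionsUpTo_mul_natCard_sub_le [Finite V] [Nontrivial V] [Finite E] {χ : ℕ}
    (hχ₀ : 0 < χ) (hχ : ∀ C, IsCut C → χ ≤ G.cutSize C) {a N : ℝ} (ha : 0 ≤ a)
    (hN : ∀ e ∈ G.crossing ⊥,
      ({C ∈ G.partitionsUpTo (a * χ / 2) | e ∉ G.crossing C}.ncard : ℝ) ≤ N) :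
    ((G.partitionsUpTo (a * χ / 2)).ncard : ℝ) * (Nat.card V - a) ≤ Nat.card V * N := by
  have hcount := ncard_partitionsUpTo_mul_cutSize_bot_sub_le hN
  have hdeg : (Nat.card V : ℝ) * χ ≤ 2 * G.cutSize ⊥ := by
    exact_mod_cast card_mul_le_two_mul_cutSize_bot hχ
  have hn : (0 : ℝ) < Nat.card V := Nat.cast_pos.2 Nat.card_pos
  have hχ₀ : (0 : ℝ) < χ := Nat.cast_pos.2 hχ₀
  set n := (Nat.card V : ℝ)
  set M := (G.cutSize ⊥ : ℝ)
  set P := ((G.partitionsUpTo (a * χ / 2)).ncard : ℝ)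
  have hM : 0 < M := by nlinarith
  have havg : M * (n - a) ≤ n * (M - a * χ / 2) := by nlinarith
  refine le_of_mul_le_mul_right ?_ hM
  calc P * (n - a) * M = P * (M * (n - a)) := by ring
    _ ≤ P * (n * (M - a * χ / 2)) := by gcongr
    _ = n * (P * (M - a * χ / 2)) := by ring
    _ ≤ n * (M * N) := by gcongr
    _ = n * N * M := by ring

theorem ncard_partitionsUpTo_mul_Gamma_le [Finite V] [Finite E] {χ : ℕ}
    (hχ₀ : 0 < χ) (hχ : ∀ C, IsCut C → χ ≤ G.cutSize C) {a : ℝ} (ha : 1 ≤ a)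
    (haV : a ≤ Nat.card V) :
    ((G.partitionsUpTo (a * χ / 2)).ncard : ℝ) * Real.Gamma (Nat.card V + 1 - a) ≤
      (Nat.card V).factorial := by
  induction hn : Nat.card V generalizing V E with
  | zero => rw [hn] at haV; norm_num at haV; linarith
  | succ m ih =>
    rw [hn] at haV
    rcases lt_or_ge (m : ℝ) a with ham | ham
    · have hP : ((G.partitionsUpTo (a * χ / 2)).ncard : ℝ) ≤ (m + 1).factorial :=
        Nat.cast_le.2 (hn ▸ ncard_partitionsUpTo_le_factorial G _)
      push_cast at haV
      refine (mul_le_of_le_one_right (Nat.cast_nonneg _) ?_).trans hP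
      push_cast
      exact Gamma_le_one_of_mem_Icc ⟨by linarith, by linarith⟩
    · have hm : (1 : ℝ) ≤ m := ha.trans ham
      have : Nontrivial V := by
        rw [← Finite.one_lt_card_iff_nontrivial, hn]
        exact Nat.lt_add_of_pos_left (Nat.cast_pos.1 (one_pos.trans_le hm))
      have hΓ : 0 < Real.Gamma (m + 1 - a) := Real.Gamma_pos_of_pos (by linarith)
      have hcontract : ∀ e ∈ G.crossing ⊥,
          ({C ∈ G.partitionsUpTo (a * χ / 2) | e ∉ G.crossing C}.ncard : ℝ) ≤
            m.factorial / Real.Gamma (m + 1 - a) := fun e he => by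
        have hcard := natCard_quotient_contractSetoid_add_one he
        have hcard : Nat.card (Quotient (G.contractSetoid e)) = m := by omega
        refine (Nat.cast_le.2 (ncard_partitionsUpTo_not_crossing_le G e _)).trans ?_
        rw [le_div_iff₀ hΓ]
        refine ih (fun D hD => ?_) (hcard ▸ ham) hcard
        rw [cutSize_contract]
        exact hχ _ (isCut_comap_mk hD)
      have hstep := ncard_partitionsUpTo_mul_natCard_sub_le hχ₀ hχ (zero_le_one.trans ha) hcontract
      rw [hn, ← mul_div_assoc, le_div_iff₀ hΓ] at hstep
      have hrec : Real.Gamma (↑(m + 1) + 1 - a) = (↑(m + 1) - a) * Real.Gamma (m + 1 - a) := by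
        rw [Nat.cast_succ, add_sub_right_comm, Real.Gamma_add_one (by linarith)]
      calc _ ≤ ((m + 1 : ℕ) : ℝ) * m.factorial := by rwa [hrec, ← mul_assoc]
        _ = (m + 1).factorial := by rw [Nat.factorial_succ, Nat.cast_mul]

theorem ncard_partitionsUpTo_le_rpow [Finite V] [Finite E] [Nonempty V] {χ : ℕ}
    (hχ₀ : 0 < χ) (hχ : ∀ C, IsCut C → χ ≤ G.cutSize C) {a : ℝ} (ha : 1 ≤ a) :
    ((G.partitionsUpTo (a * χ / 2)).ncard : ℝ) ≤ (Nat.card V : ℝ) ^ a := by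
  rcases le_or_gt a (Nat.card V) with haV | haV
  · have hΓ : 0 < Real.Gamma (Nat.card V + 1 - a) := Real.Gamma_pos_of_pos (by linarith)
    refine le_of_mul_le_mul_right ?_ hΓ
    calc _ ≤ ((Nat.card V).factorial : ℝ) := ncard_partitionsUpTo_mul_Gamma_le hχ₀ hχ ha haV
      _ = Real.Gamma (Nat.card V + 1) := (Real.Gamma_nat_eq_factorial _).symm
      _ ≤ _ := Gamma_add_one_le_rpow_mul_Gamma ha (by linarith)
  · calc ((G.partitionsUpTo (a * χ / 2)).ncard : ℝ)
        ≤ (Nat.card V).factorial := Nat.cast_le.2 (ncard_partitionsUpTo_le_factorial G _)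
      _ ≤ (Nat.card V : ℝ) ^ (Nat.card V : ℝ) := by
          rw [Real.rpow_natCast]
          exact_mod_cast Nat.factorial_le_pow _
      _ ≤ (Nat.card V : ℝ) ^ a := by
          gcongr
          exact Nat.one_le_cast.2 Nat.card_pos

/-- With `s C = |C| / χ`, at most `(n ^ 2) ^ b` partitions have `s C ≤ b`, while
`p ^ |C| = (p ^ χ) ^ s C`. -/
theorem sum_pow_cutSize_le [Finite V] [Finite E] [Nontrivial V] {χ : ℕ}
    (hχ₀ : 0 < χ) (hχ : ∀ C, IsCut C → χ ≤ G.cutSize C) {p α : ℝ} (hp : 0 < p)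
    (hpχ : p ^ χ ≤ (Nat.card V : ℝ) ^ (-4 : ℝ)) (hα : 1 / 2 ≤ α) {F : Finset (Setoid V)}
    (hF : ∀ C ∈ F, α * χ ≤ G.cutSize C) :
    ∑ C ∈ F, p ^ G.cutSize C ≤ 4 * ((Nat.card V : ℝ) ^ 2 * p ^ χ) ^ α := by
  have hn : (1 : ℝ) < Nat.card V := Nat.one_lt_cast.2 Finite.one_lt_card
  have hn₀ : (0 : ℝ) ≤ Nat.card V := by linarith
  have hχ₁ : (0 : ℝ) < χ := Nat.cast_pos.2 hχ₀
  have hsize (C : Setoid V) : p ^ G.cutSize C = (p ^ χ) ^ ((G.cutSize C : ℝ) / χ) := by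
    rw [← Real.rpow_natCast, ← Real.rpow_natCast, ← Real.rpow_mul hp.le, mul_div_cancel₀ _ hχ₁.ne']
  simp only [hsize]
  refine sum_rpow_le_of_card_filter_le (one_lt_pow₀ hn two_ne_zero) (by positivity) ?_
    (fun C hC => (le_div_iff₀ hχ₁).2 (hF C hC)) fun b hb => ?_
  · rwa [← Real.rpow_natCast_mul hn₀, show ((2 : ℕ) : ℝ) * -2 = -4 by norm_num]
  · rw [← Real.rpow_natCast_mul hn₀, ← Set.ncard_coe_finset]
    refine (Nat.cast_le.2 (Set.ncard_le_ncard (fun C hC => ?_) (Set.toFinite _))).trans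
      (ncard_partitionsUpTo_le_rpow hχ₀ hχ (by push_cast; linarith))
    have hCb : (G.cutSize C : ℝ) / χ ≤ b := (Finset.mem_filter.1 hC).2
    rw [div_le_iff₀ hχ₁] at hCb
    rw [mem_partitionsUpTo]
    push_cast
    linarith

end Multigraph

theorem IsDistanceCumulative.connected_of_eq_zero {Φ : WeightedGraph.{u, v} → ℝ≥0∞}
    (hΦ : IsDistanceCumulative Φ) {H : WeightedGraph.{u, v}} (hH : Φ H = 0) :
    (H.graph.restrict {e | H.weight e = 0}).Connected := by
  have hconn : H.graph.Connected := not_not.1 fun h =>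
    ENNReal.zero_ne_top (hH.symm.trans (hΦ.eq_top H h))
  exact (hΦ.positive H hconn).1 hH

namespace BCWGraph

variable {V : Type u} {E : Type v}

/-- The probability of the single instance `I`; `G.Pr A` is the sum of these over `I ∈ A`. -/
def instanceProb [Fintype E] (G : BCWGraph V E) (I : E → Bool) : ℝ :=
  ∏ e, if I e then G.prob e else 1 - G.prob e

section Pr

variable [Fintype E] (G : BCWGraph V E)

theorem instanceProb_nonneg (I : E → Bool) : 0 ≤ G.instanceProb I := by
  refine Finset.prod_nonneg fun e _ => ?_
  split_ifs
  exacts [(G.prob_pos e).le, sub_nonneg.2 (G.prob_lt_one e).le]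

theorem Pr_eq_sum_toFinset (A : Set (E → Bool)) [Fintype A] :
    G.Pr A = ∑ I ∈ A.toFinset, G.instanceProb I := by
  rw [Pr, ← Finset.sum_filter]
  refine Finset.sum_congr ?_ fun _ _ => rfl
  ext I
  simp

theorem Pr_mono {A B : Set (E → Bool)} (h : A ⊆ B) : G.Pr A ≤ G.Pr B := by
  classical
  rw [Pr_eq_sum_toFinset, Pr_eq_sum_toFinset]
  exact Finset.sum_le_sum_of_subset_of_nonneg (Set.toFinset_mono h) fun I _ _ =>
    G.instanceProb_nonneg I

theorem Pr_exists_le {ι : Type*} (F : Finset ι) (A : ι → Set (E → Bool)) :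
    G.Pr {I | ∃ i ∈ F, I ∈ A i} ≤ ∑ i ∈ F, G.Pr (A i) := by
  classical
  have hunion : {I | ∃ i ∈ F, I ∈ A i}.toFinset =
      (F.sigma fun i => (A i).toFinset).image Sigma.snd := by
    ext I
    simp
  simp only [Pr_eq_sum_toFinset, hunion]
  rw [Finset.sum_sigma']
  exact Finset.sum_image_le_of_nonneg fun I _ => G.instanceProb_nonneg I

theorem Pr_forall_heavy (S : Finset E) :
    G.Pr {I | ∀ e ∈ S, I e = true} = ∏ e ∈ S, G.prob e := by
  classical
  have hpi : {I : E → Bool | ∀ e ∈ S, I e = true}.toFinset =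
      Fintype.piFinset fun e => if e ∈ S then {true} else Finset.univ := by
    ext I
    rw [Set.mem_toFinset, Fintype.mem_piFinset]
    refine forall_congr' fun e => ?_
    by_cases he : e ∈ S <;> simp [he]
  calc G.Pr {I | ∀ e ∈ S, I e = true}
      = ∏ e, ∑ b ∈ if e ∈ S then {true} else Finset.univ,
          if b then G.prob e else 1 - G.prob e := by
        rw [Pr_eq_sum_toFinset, hpi, Finset.prod_univ_sum]
        rfl
    _ = ∏ e, if e ∈ S then G.prob e else 1 :=
        Finset.prod_congr rfl fun e _ => by by_cases he : e ∈ S <;> simp [he]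
    _ = ∏ e ∈ S, G.prob e := Fintype.prod_ite_mem S G.prob

theorem Pr_allHeavy {p : ℝ} (hp : ∀ e ∈ G.zeroEdges, G.prob e = p) (C : Setoid V) :
    G.Pr (G.AllHeavy C) = p ^ G.zeroGraph.cutSize C := by
  classical
  let S : Finset E := (G.zeroGraph.crossing C).toFinset.map (Function.Embedding.subtype _)
  have hS : G.AllHeavy C = {I | ∀ e ∈ S, I e = true} := by
    ext I
    simp [S, AllHeavy]
  rw [hS, Pr_forall_heavy, Finset.prod_map, Multigraph.cutSize, Set.ncard_eq_toFinset_card']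
  exact Finset.prod_eq_pow_card fun e _ => hp e e.2

end Pr

section PositiveEvent

variable [Finite V] {G : BCWGraph V E} {Φ : WeightedGraph.{u, v} → ℝ≥0∞}

theorem allHeavy_subset_positiveEvent [Finite E] (hheavy : ∀ e, 0 < G.heavy e)
    (hΦ : ∀ H, Φ H = 0 → (H.graph.restrict {e | H.weight e = 0}).Connected) {C : Setoid V}
    (hC : Multigraph.IsCut C) : G.AllHeavy C ⊆ G.positiveEvent Φ := by
  intro I hI
  refine pos_iff_ne_zero.2 (?_ : Φ (G.realize I) ≠ 0)
  intro hzero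
  have hconn : (G.graph.restrict {e | (G.realize I).weight e = 0}).Connected := hΦ _ hzero
  obtain ⟨⟨e, hweight⟩, hcross⟩ := hconn.nonempty_crossing hC
  have hweight : (if I e then G.heavy e else G.light e) = 0 := hweight
  cases hIe : I e with
  | true => exact (hheavy e).ne' (by simpa [hIe] using hweight)
  | false =>
    have hlight : G.light e = 0 := by simpa [hIe] using hweight
    exact Bool.false_ne_true (hIe.symm.trans (hI ⟨e, hlight⟩ hcross))

theorem pow_minCutSize_le_Pr_positiveEvent [Nontrivial V] [Fintype E]
    (hheavy : ∀ e, 0 < G.heavy e)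
    (hΦ : ∀ H, Φ H = 0 → (H.graph.restrict {e | H.weight e = 0}).Connected) {p : ℝ}
    (hp : ∀ e ∈ G.zeroEdges, G.prob e = p) :
    p ^ G.zeroGraph.minCutSize ≤ G.Pr (G.positiveEvent Φ) := by
  obtain ⟨C, hC, hsize⟩ := G.zeroGraph.exists_cutSize_eq_minCutSize
  rw [← hsize, ← G.Pr_allHeavy hp]
  exact G.Pr_mono (allHeavy_subset_positiveEvent hheavy hΦ hC)

end PositiveEvent

end BCWGraph

theorem four_add_half_lt_cutConst : 4 + 1 / 2 < cutConst := by
  have hsqrt : (4 : ℝ) < √17 := Real.lt_sqrt_of_sq_lt (by norm_num)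
  rw [cutConst]
  linarith

theorem cutConst_quadratic : (cutConst - 1) * (cutConst - 2) / 2 = cutConst := by
  have hsq : √17 ^ 2 = (17 : ℝ) := Real.sq_sqrt (by norm_num)
  rw [cutConst]
  linear_combination hsq / 8

section Tail

variable {n : ℕ} {ε : ℝ}

theorem one_lt_cutAlpha (hε : 0 < ε) (hε₁ : ε ≤ 1) : 1 < cutAlpha n ε := by
  have hlog : 0 ≤ Real.log (1 / ε) / Real.log n :=
    div_nonneg (Real.log_nonneg ((one_le_div hε).2 hε₁)) (Real.log_natCast_nonneg n)
  have hc := four_add_half_lt_cutConst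
  rw [cutAlpha]
  linarith

theorem rpow_two_mul_cutAlpha (hn : 2 ≤ n) (hε : 0 < ε) :
    (n : ℝ) ^ (2 * cutAlpha n ε) = n ^ (cutConst - 1) / ε := by
  have hn₁ : (1 : ℝ) < n := Nat.one_lt_cast.2 hn
  rw [cutAlpha, mul_div_cancel₀ _ two_ne_zero, Real.rpow_add (by linarith), Real.log_div_log,
    Real.rpow_logb (by linarith) hn₁.ne' (by positivity), mul_one_div]

/-- The value of `cutConst` is chosen so that no power of `n` is left on the right. -/
theorem rpow_two_mul_cutAlpha_mul_rpow (hn : 2 ≤ n) (hε : 0 < ε) :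
    (n : ℝ) ^ (2 * cutAlpha n ε) * ((n : ℝ) ^ (-cutConst)) ^ (cutAlpha n ε - 1) =
      ε ^ ((cutConst - 2) / 2) := by
  have hn₀ : (0 : ℝ) < n := Nat.cast_pos.2 (by omega)
  set α := cutAlpha n ε with hα
  calc (n : ℝ) ^ (2 * α) * ((n : ℝ) ^ (-cutConst)) ^ (α - 1)
      = n ^ cutConst * ((n : ℝ) ^ (2 * α)) ^ (-((cutConst - 2) / 2)) := by
        rw [← Real.rpow_mul hn₀.le, ← Real.rpow_mul hn₀.le, ← Real.rpow_add hn₀,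
          ← Real.rpow_add hn₀]
        ring_nf
    _ = n ^ cutConst * n ^ (-cutConst) * ε ^ ((cutConst - 2) / 2) := by
        rw [hα, rpow_two_mul_cutAlpha hn hε, Real.div_rpow (by positivity) hε.le,
          Real.rpow_neg hε.le, div_inv_eq_mul, ← Real.rpow_mul hn₀.le, mul_neg, ← mul_div_assoc,
          cutConst_quadratic, mul_assoc]
    _ = ε ^ ((cutConst - 2) / 2) := by
        rw [← Real.rpow_add hn₀, add_neg_cancel, Real.rpow_zero, one_mul]

theorem rpow_half_cutConst_sub_two_le (hε : 0 < ε) (hε₀ : ε ≤ (1 / 16) ^ 4) :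
    ε ^ ((cutConst - 2) / 2) ≤ ε / 16 := by
  have hc := four_add_half_lt_cutConst
  calc ε ^ ((cutConst - 2) / 2) ≤ ε ^ (1 + 1 / 4 : ℝ) :=
        Real.rpow_le_rpow_of_exponent_ge hε (hε₀.trans (by norm_num)) (by linarith)
    _ = ε * ε ^ (1 / 4 : ℝ) := by rw [Real.rpow_one_add' hε.le (by norm_num)]
    _ ≤ ε * ((1 / 16) ^ 4) ^ (1 / 4 : ℝ) := by gcongr
    _ = ε / 16 := by
        rw [← Real.rpow_natCast_mul (by norm_num)]
        norm_num
        ring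

theorem four_mul_rpow_cutAlpha_le (hn : 2 ≤ n) (hε : 0 < ε) (hε₀ : ε ≤ (1 / 16) ^ 4) {x : ℝ}
    (hx : 0 < x) (hxn : x ≤ (n : ℝ) ^ (-cutConst)) :
    4 * ((n : ℝ) ^ 2 * x) ^ cutAlpha n ε ≤ ε * x / 4 := by
  have hα := one_lt_cutAlpha (n := n) hε (hε₀.trans (by norm_num))
  set α := cutAlpha n ε with hα_def
  calc 4 * ((n : ℝ) ^ 2 * x) ^ α = 4 * (n ^ (2 * α) * x ^ (α - 1)) * x := by
        rw [Real.mul_rpow (by positivity) hx.le, ← Real.rpow_natCast_mul (Nat.cast_nonneg n),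
          Real.rpow_sub_one hx.ne']
        push_cast
        field_simp
    _ ≤ 4 * (n ^ (2 * α) * ((n : ℝ) ^ (-cutConst)) ^ (α - 1)) * x := by gcongr
    _ ≤ 4 * (ε / 16) * x := by
        rw [hα_def, rpow_two_mul_cutAlpha_mul_rpow hn hε]
        gcongr
        exact rpow_half_cutConst_sub_two_le hε hε₀
    _ = ε * x / 4 := by ring

end Tail

theorem BCWGraph.Pr_exists_allHeavy_le {V : Type u} {E : Type v} [Fintype V] [Fintype E]
    (G : BCWGraph V E) {p ε : ℝ} (hV : 2 ≤ Fintype.card V) (hp : ∀ e ∈ G.zeroEdges, G.prob e = p)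
    (hpχ : p ^ G.zeroGraph.minCutSize ≤ (Fintype.card V : ℝ) ^ (-cutConst))
    (hε : 0 < ε) (hε₀ : ε ≤ (1 / 16) ^ 4) :
    G.Pr {I | ∃ C, cutAlpha (Fintype.card V) ε * G.zeroGraph.minCutSize < G.zeroGraph.cutSize C ∧
        I ∈ G.AllHeavy C} ≤ ε * p ^ G.zeroGraph.minCutSize / 4 := by
  classical
  have := Fintype.one_lt_card_iff_nontrivial.1 hV
  have := Fintype.ofFinite (Setoid V)
  have hc := four_add_half_lt_cutConst
  have hn : (1 : ℝ) < Fintype.card V := Nat.one_lt_cast.2 hV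
  have hχ : 0 < G.zeroGraph.minCutSize := by
    refine Nat.pos_of_ne_zero fun hzero => hpχ.not_gt ?_
    rw [hzero, pow_zero]
    exact Real.rpow_lt_one_of_one_lt_of_neg hn (by linarith)
  obtain ⟨e⟩ := Multigraph.nonempty_of_minCutSize_pos hχ
  have hp₀ : 0 < p := hp e e.2 ▸ G.prob_pos e
  have hα := one_lt_cutAlpha (n := Fintype.card V) hε (hε₀.trans (by norm_num))
  have hpχ₄ : p ^ G.zeroGraph.minCutSize ≤ (Fintype.card V : ℝ) ^ (-4 : ℝ) :=
    hpχ.trans (Real.rpow_le_rpow_of_exponent_le hn.le (by linarith))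
  set χ := G.zeroGraph.minCutSize
  set α := cutAlpha (Fintype.card V) ε
  let F : Finset (Setoid V) := {C | α * χ < G.zeroGraph.cutSize C}
  have hF : ∀ C ∈ F, α * χ ≤ G.zeroGraph.cutSize C := fun C hC => (Finset.mem_filter.1 hC).2.le
  calc G.Pr {I | ∃ C, α * χ < G.zeroGraph.cutSize C ∧ I ∈ G.AllHeavy C}
      = G.Pr {I | ∃ C ∈ F, I ∈ G.AllHeavy C} := by
        simp only [F, Finset.mem_filter, Finset.mem_univ, true_and]
    _ ≤ ∑ C ∈ F, G.Pr (G.AllHeavy C) := G.Pr_exists_le F _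
    _ = ∑ C ∈ F, p ^ G.zeroGraph.cutSize C := Finset.sum_congr rfl fun C _ => G.Pr_allHeavy hp C
    _ ≤ 4 * ((Fintype.card V : ℝ) ^ 2 * p ^ χ) ^ α := by
        rw [← Nat.card_eq_fintype_card] at hpχ₄ ⊢
        exact Multigraph.sum_pow_cutSize_le hχ (fun _ => Multigraph.minCutSize_le_cutSize) hp₀ hpχ₄
          (by linarith) hF
    _ ≤ ε * p ^ χ / 4 := four_mul_rpow_cutAlpha_le hV hε hε₀ (by positivity) hpχ

theorem mainTheorem5_general {V : Type u} {E : Type v} [Fintype V] [Fintype E] (G : BCWGraph V E)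
    {Φ : WeightedGraph.{u, v} → ℝ≥0∞} {p ε : ℝ}
    (hΦ : ∀ H, Φ H = 0 → (H.graph.restrict {e | H.weight e = 0}).Connected)
    (hV : 2 ≤ Fintype.card V) (hheavy : ∀ e, 0 < G.heavy e)
    (hp : ∀ e ∈ G.zeroEdges, G.prob e = p)
    (hPr : G.Pr (G.positiveEvent Φ) < (Fintype.card V : ℝ) ^ (-cutConst))
    (hε : 0 < ε) (hε₀ : ε ≤ (1 / 16) ^ 4) :
    G.Pr {I | ∃ C, cutAlpha (Fintype.card V) ε * G.zeroGraph.minCutSize < G.zeroGraph.cutSize C ∧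
        I ∈ G.AllHeavy C} ≤ ε * p ^ G.zeroGraph.minCutSize / 4 ∧
      ε * p ^ G.zeroGraph.minCutSize / 4 ≤ ε * G.Pr (G.positiveEvent Φ) / 4 := by
  have := Fintype.one_lt_card_iff_nontrivial.1 hV
  have hle := BCWGraph.pow_minCutSize_le_Pr_positiveEvent hheavy hΦ hp
  exact ⟨G.Pr_exists_allHeavy_le hV hp (hle.trans hPr.le) hε hε₀, by gcongr⟩

theorem mainTheorem5 :
    ∃ ε₀ : ℝ, 0 < ε₀ ∧
      ∀ (V : Type u) [Fintype V] (E : Type v) [Fintype E] (G : BCWGraph V E)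
        (Φ : WeightedGraph.{u, v} → ℝ≥0∞) (p ε : ℝ),
        IsDistanceCumulative Φ →
        2 ≤ Fintype.card V →
        G.graph.Connected →
        (∀ e, 0 < G.heavy e) →
        (∀ e ∈ G.zeroEdges, G.prob e = p) →
        G.Pr (G.positiveEvent Φ) < (Fintype.card V : ℝ) ^ (-cutConst) →
        0 < ε → ε ≤ ε₀ →
        G.Pr {I | ∃ C : Setoid V, G.zeroGraph.IsCompactCut C ∧
              C ∉ G.zeroGraph.compactCutsUpTo
                (cutAlpha (Fintype.card V) ε * (G.zeroGraph.minCutSize : ℝ)) ∧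
              I ∈ G.AllHeavy C}
            ≤ ε * p ^ G.zeroGraph.minCutSize / 4 ∧
          ε * p ^ G.zeroGraph.minCutSize / 4 ≤ ε * G.Pr (G.positiveEvent Φ) / 4 := by
  refine ⟨(1 / 16) ^ 4, by norm_num, ?_⟩
  intro V _ E _ G Φ p ε hΦ hV _ hheavy hp hPr hε hε₀
  have ⟨htail, hpos⟩ :=
    mainTheorem5_general G (fun _ => hΦ.connected_of_eq_zero) hV hheavy hp hPr hε hε₀
  refine ⟨(G.Pr_mono ?_).trans htail, hpos⟩
  rintro I ⟨C, hC, hlarge, hI⟩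
  exact ⟨C, not_le.1 fun h => hlarge ⟨hC, h⟩, hI⟩
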